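/- Let $\mathcal D$ be a finite-dimensional unital associative real algebra whose center $Z(\mathcal D)$ has real dimension $1$ or $2$. Suppose that $\mathcal D=\bigoplus_{g\in G}\mathcal D_g$ is a grading by a group $G$ (that is, $\mathcal D_g\mathcal D_h\subseteq\mathcal D_{gh}$ for all $g,h\in G$) such that every nonzero homogeneous element is invertible, every nonzero component $\mathcal D_g$ has dimension $1$, and the support $T=\{g\in G : \mathcal D_g\neq 0\}$ is a subgroup of $G$ isomorphic to $\mathbb Z_2^N$, where $N\ge 0$. Then there is a unique map $\mu:T\to\{\pm1\}$ such that for every $t\in T$ some $X_t\in\mathcal D_t$ satisfies $X_t^2=\mu(t)1$. This $\mu$ is a quadratic form, i.e. its polarization $\beta_\mu(u,v)=\mu(uv)\mu(u)^{-1}\mu(v)^{-1}$ is multiplicative in each variable and satisfies $\beta_\mu(u,u)=1$ for all $u\in T$. Let $\operatorname{Arf}(\mu)\in\{1,0,-1\}$ be the sign of $|\mu^{-1}(+1)|-|\mu^{-1}(-1)|$. The Arf invariant determines the real algebra $\mathcal D$ up to isomorphism, as follows. - $\dim Z(\mathcal D)=1$ if and only if $N=2m$ for some integer $m\ge 0$.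 In this case $\operatorname{Arf}(\mu)\in\{1,-1\}$, and - if $\operatorname{Arf}(\mu)=1$, then $\mathcal D\cong M_{2^m}(\mathbb R)$; - if $\operatorname{Arf}(\mu)=-1$, then $m\ge 1$ and $\mathcal D\cong M_{2^{m-1}}(\mathbb H)$. - $\dim Z(\mathcal D)=2$ if and only if $N=2m+1$ for some integer $m\ge 0$. In this case - if $\operatorname{Arf}(\mu)=1$, then $\mathcal D\cong M_{2^m}(\mathbb R)\times M_{2^m}(\mathbb R)$; - if $\operatorname{Arf}(\mu)=0$, then $\mathcal D\cong M_{2^m}(\mathbb C)$; - if $\operatorname{Arf}(\mu)=-1$, then $m\ge 1$ and $\mathcal D\cong M_{2^{m-1}}(\mathbb H)\times M_{2^{m-1}}(\mathbb H)$. All isomorphisms are isomorphisms of real algebras. -/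

import Mathlib

namespace DivGrad

/-- The support of a family of subspaces: the degrees with a nonzero component. -/
def support {G D : Type*} [Ring D] [Algebra ℝ D] (𝒜 : G → Submodule ℝ D) : Set G :=
  {g | 𝒜 g ≠ ⊥}

/-- A grading is a division grading if every nonzero homogeneous element is invertible. -/
def IsDivisionGrading {G D : Type*} [Ring D] [Algebra ℝ D] (𝒜 : G → Submodule ℝ D) : Prop :=
  ∀ g : G, ∀ x ∈ 𝒜 g, x ≠ 0 → IsUnit x

/-- Alternating bicharacters `T × T → A`, with `T` written additively and the abelian group `A`
of values written multiplicatively. -/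
structure IsAlternatingBicharacter {T A : Type*} [AddGroup T] [CommGroup A]
    (β : T → T → A) : Prop where
  add_left : ∀ u v w : T, β (u + v) w = β u w * β v w
  add_right : ∀ u v w : T, β u (v + w) = β u v * β u w
  self : ∀ u : T, β u u = 1

/-- The polarization of `μ : T → {±1}`. -/
def polarization {T : Type*} [AddGroup T] (μ : T → ℤˣ) (u v : T) : ℤˣ :=
  μ (u + v) * (μ u)⁻¹ * (μ v)⁻¹

/-- `μ : T → {±1}` is a quadratic form if its polarization is an alternating bicharacter. -/
def IsQuadraticForm {T : Type*} [AddGroup T] (μ : T → ℤˣ) : Prop :=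
  IsAlternatingBicharacter (polarization μ)

/-- The Arf invariant of a map `μ : T → {±1}` on a finite set: the value assumed most often,
and `0` if both values are assumed equally often. -/
noncomputable def arf {T : Type*} (μ : T → ℤˣ) : ℤ :=
  Int.sign ((Nat.card {t : T // μ t = 1} : ℤ) - (Nat.card {t : T // μ t = -1} : ℤ))

/-- `μ` is the sign of the squares of the homogeneous elements with degree in `T`: for every
`t ∈ T` there is a (necessarily nonzero) element `X` of degree `t` with `X² = μ(t) 1`. -/
def IsSignOfSquares {G D : Type*} [AddGroup G] [Ring D] [Algebra ℝ D]
    (𝒜 : G → Submodule ℝ D) (T : AddSubgroup G) (μ : T → ℤˣ) : Prop :=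
  ∀ t : T, ∃ X ∈ 𝒜 (t : G), X ^ 2 = algebraMap ℝ D (((μ t : ℤˣ) : ℤ) : ℝ)

end DivGrad

/-!
Choose in each component of degree `t ∈ T` an element `b t` with square `μ t = ±1`, and `b 0 = 1`.
The components are one-dimensional, so `b` is a basis with `b u * b v = ± b (u + v)`, a *signed
basis* (`IsSignedBasis`, `DivGrad.exists_isSignedBasis`). Evaluating `(b u * b v) ^ 2` in two ways
shows that `b u * b v = β (u, v) b v * b u` for the polarization `β` of `μ`
(`IsSignedBasis.mul_eq_polarization_smul`). Hence `β` is an alternating bicharacter, and the center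
is spanned by the `b t` with `t` in the radical of `β` (`IsSignedBasis.finrank_center`), so that the
radical has order one or two.

If `b u` and `b v` anticommute, they generate a quaternion algebra, and `D` is its tensor product
with the span `C` of the `b t` for `t` orthogonal to `u` and `v`
(`IsSignedBasis.nonempty_tensor_quaternion_algEquiv`). The index group of `C` has index four and the
same radical, and `∑ μ` is multiplied by `1 + μ u + μ v - μ u μ v` in passing from `C` to `D`
(`DivGrad.signSum_eq_mul`). Three cases remain, and the classification is by induction on the order
of the index group (`IsSignedBasis.hasMatrixForm`).

* There are such `u`, `v` with `μ u = μ v = 1`. The quaternion algebra is `M₂(ℝ)`, so that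
  `D ≅ M₂(C)`, and the Arf invariant of `C` is that of `D`.
* There are such `u`, `v`, but never with `μ u = μ v = 1`. Since `μ u μ v μ (u + v) = -1` for every
  such pair, all three signs are `-1`. This forces `μ = 1` on the complement of the pair, which is
  then the radical; so `D` is `ℍ` or `ℍ × ℍ`, with Arf invariant `-1`.
* There are no such `u`, `v`. The index group is the radical, and `D` is `ℝ`, `ℝ × ℝ` or `ℂ`.
-/

/-! ### Signed bases -/

/-- A basis `b` of a real algebra, indexed by an abelian group, that is multiplicative up to
signs and whose members have square `±1`, the sign being recorded by `μ`. Such bases are the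
choices of normalized homogeneous elements in a division grading with one-dimensional
components and elementary abelian support. -/
structure IsSignedBasis {T D : Type*} [AddCommGroup T] [Ring D] [Algebra ℝ D]
    (b : Module.Basis T ℝ D) (μ : T → ℤˣ) : Prop where
  zero : b 0 = 1
  mul : ∀ u v, ∃ ε : ℤˣ, b u * b v = ε • b (u + v)
  sq : ∀ u, b u * b u = μ u • (1 : D)

theorem units_int_smul_right_injective {D : Type*} [Ring D] [Algebra ℝ D] {x : D} (hx : x ≠ 0)
    {ε δ : ℤˣ} (h : ε • x = δ • x) : ε = δ := by
  have aux : x ≠ -x := fun h' => hx <| by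
    have : (2 : ℝ) • x = 0 := by rw [two_smul]; nth_rw 2 [h']; simp
    simpa using this
  rcases Int.units_eq_one_or ε with rfl | rfl <;> rcases Int.units_eq_one_or δ with rfl | rfl
  · rfl
  · exact absurd (by simpa [Units.smul_def] using h) aux
  · exact absurd (by simpa [Units.smul_def] using h.symm) aux
  · rfl

theorem units_int_smul_eq_real_smul {D : Type*} [Ring D] [Algebra ℝ D] (ε : ℤˣ) (x : D) :
    ε • x = (((ε : ℤ)) : ℝ) • x := by
  rw [Units.smul_def, Int.cast_smul_eq_zsmul]

theorem units_int_inv_eq (ε : ℤˣ) : ε⁻¹ = ε := Int.units_inv_eq_self ε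

namespace DivGrad

theorem polarization_comm {T : Type*} [AddCommGroup T] (μ : T → ℤˣ) (u v : T) :
    polarization μ u v = polarization μ v u := by
  simp only [polarization, add_comm u v]; rw [mul_assoc, mul_comm (μ u)⁻¹, ← mul_assoc]

theorem map_add_eq {T : Type*} [AddCommGroup T] (μ : T → ℤˣ) (u v : T) :
    μ (u + v) = μ u * μ v * polarization μ u v := by
  rw [polarization, mul_assoc (μ (u + v)), ← mul_inv, mul_left_comm, mul_inv_cancel, mul_one]

/-- The radical of the polarization of `μ`. -/
def radical {T : Type*} [AddCommGroup T] (μ : T → ℤˣ) : Set T :=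
  {t | ∀ s, polarization μ t s = 1}

end DivGrad

namespace IsSignedBasis

open DivGrad

variable {T D : Type*} [AddCommGroup T] [Ring D] [Algebra ℝ D] {b : Module.Basis T ℝ D}
  {μ : T → ℤˣ}

theorem isUnit (h : IsSignedBasis b μ) (u : T) : IsUnit (b u) := by
  refine ⟨⟨b u, μ u • b u, ?_, ?_⟩, rfl⟩
  · rw [mul_smul_comm, h.sq, smul_smul, Int.units_mul_self, one_smul]
  · rw [smul_mul_assoc, h.sq, smul_smul, Int.units_mul_self, one_smul]

theorem nontrivial (_ : IsSignedBasis b μ) : Nontrivial D := ⟨b 0, 0, b.ne_zero 0⟩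

theorem mul_ne_zero (h : IsSignedBasis b μ) (u v : T) : b u * b v ≠ 0 :=
  have := h.nontrivial
  ((h.isUnit u).mul (h.isUnit v)).ne_zero

/-- The index group of a signed basis has exponent two. -/
theorem add_self (h : IsSignedBasis b μ) (u : T) : u + u = 0 := by
  by_contra hu
  obtain ⟨ε, hε⟩ := h.mul u u
  rw [h.sq, ← h.zero, units_int_smul_eq_real_smul, units_int_smul_eq_real_smul] at hε
  have := congrArg (fun x => b.repr x 0) hε
  simp [hu] at this

/-- Two members of a signed basis commute up to the value of the polarization. -/
theorem mul_eq_polarization_smul (h : IsSignedBasis b μ) (u v : T) :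
    b u * b v = polarization μ u v • (b v * b u) := by
  obtain ⟨ε, hε⟩ := h.mul u v
  obtain ⟨δ, hδ⟩ := h.mul v u
  have huv : b u * b v = (ε * δ) • (b v * b u) := by
    rw [hδ, smul_smul, mul_assoc, Int.units_mul_self, mul_one, add_comm v u, hε]
  -- compare two evaluations of the square of `b u * b v`
  have h1 : (b u * b v) * (b u * b v) = μ (u + v) • (1 : D) := by
    rw [hε, smul_mul_smul_comm, Int.units_mul_self, one_smul, h.sq]
  have h2 : (b u * b v) * (b u * b v) = (ε * δ * (μ u * μ v)) • (1 : D) := by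
    calc (b u * b v) * (b u * b v) = ((ε * δ) • (b v * b u)) * (b u * b v) := by rw [← huv]
      _ = (ε * δ) • (b v * ((b u * b u) * b v)) := by rw [smul_mul_assoc]; simp only [mul_assoc]
      _ = _ := by
        rw [h.sq, smul_mul_assoc, one_mul, mul_smul_comm, h.sq, smul_smul, smul_smul,
          mul_assoc (ε * δ)]
  have := h.nontrivial
  have h3 := units_int_smul_right_injective one_ne_zero (h1.symm.trans h2)
  rw [huv, polarization, h3, units_int_inv_eq, units_int_inv_eq]
  congr 1
  rw [mul_assoc, mul_assoc, show μ u * μ v * (μ u * μ v) = 1 from Int.units_mul_self _,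
    mul_one]

theorem polarization_eq_of_mul (h : IsSignedBasis b μ) {u v : T} {p : ℤˣ}
    (hp : b u * b v = p • (b v * b u)) : polarization μ u v = p :=
  units_int_smul_right_injective (h.mul_ne_zero v u)
    ((h.mul_eq_polarization_smul u v).symm.trans hp)

theorem isQuadraticForm (h : IsSignedBasis b μ) : IsQuadraticForm μ := by
  have left : ∀ u v w, polarization μ (u + v) w = polarization μ u w * polarization μ v w := by
    intro u v w
    obtain ⟨ε, hε⟩ := h.mul u v
    have hε' : b (u + v) = ε • (b u * b v) := by
      rw [hε, smul_smul, Int.units_mul_self, one_smul]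
    refine h.polarization_eq_of_mul ?_
    rw [hε', smul_mul_assoc, mul_assoc, h.mul_eq_polarization_smul v w, mul_smul_comm,
      ← mul_assoc, h.mul_eq_polarization_smul u w, smul_mul_assoc, smul_smul, mul_smul_comm,
      smul_smul, smul_smul, mul_assoc (b w)]
    congr 1
    ac_rfl
  refine ⟨left, fun u v w => ?_, fun u => ?_⟩
  · rw [polarization_comm, left, polarization_comm _ v, polarization_comm _ w]
  · exact h.polarization_eq_of_mul (by rw [one_smul])

theorem map_zero (h : IsSignedBasis b μ) : μ 0 = 1 := by
  have := h.nontrivial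
  have := h.sq 0
  rw [h.zero, one_mul] at this
  exact (units_int_smul_right_injective one_ne_zero (by rw [← this, one_smul])).symm

end IsSignedBasis

open DivGrad in
/-- The center of an algebra with a signed basis is spanned by the basis members whose index
lies in the radical of the polarization. -/
theorem IsSignedBasis.finrank_center {T D : Type*} [AddCommGroup T] [Finite T] [Ring D]
    [Algebra ℝ D] {b : Module.Basis T ℝ D} {μ : T → ℤˣ} (h : IsSignedBasis b μ) :
    Module.finrank ℝ (Subalgebra.center ℝ D) = Nat.card (radical μ) := by
  classical
  have := Fintype.ofFinite T
  have key : Subalgebra.toSubmodule (Subalgebra.center ℝ D) =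
      Submodule.span ℝ (Set.range fun t : radical μ => b t) := by
    apply le_antisymm
    · intro x hx
      have hx : x ∈ Subalgebra.center ℝ D := hx
      rw [Subalgebra.mem_center_iff] at hx
      rw [← b.sum_repr x]
      refine Submodule.sum_mem _ fun t _ => ?_
      by_cases ht : t ∈ radical μ
      · exact Submodule.smul_mem _ _ (Submodule.subset_span ⟨⟨t, ht⟩, rfl⟩)
      · obtain ⟨u, hu⟩ : ∃ u, polarization μ t u ≠ 1 := by simpa [radical] using ht
        -- cancelling `b u` in `b u * x = x * b u` compares coordinates
        have e : b u * ∑ t, b.repr x t • b t =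
            b u * ∑ t, (b.repr x t * ((polarization μ t u : ℤˣ) : ℤ)) • b t := by
          calc b u * ∑ t, b.repr x t • b t = (∑ t, b.repr x t • b t) * b u := by
                rw [b.sum_repr, hx]
            _ = _ := by
                rw [Finset.sum_mul, Finset.mul_sum]
                refine Finset.sum_congr rfl fun t _ => ?_
                rw [smul_mul_assoc, h.mul_eq_polarization_smul t u, mul_smul_comm,
                  units_int_smul_eq_real_smul, smul_smul]
        have e' := congrArg (fun y => b.repr y t) ((h.isUnit u).mul_left_cancel e)
        simp only [b.repr_sum_self] at e'
        rw [Int.units_ne_iff_eq_neg.mp hu] at e'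
        have : b.repr x t = 0 := by
          simp at e'; linarith
        rw [this, zero_smul]; exact Submodule.zero_mem _
    · rw [Submodule.span_le]
      rintro _ ⟨t, rfl⟩
      change b t ∈ Subalgebra.center ℝ D
      rw [Subalgebra.mem_center_iff]
      intro x
      rw [← b.sum_repr x, Finset.sum_mul, Finset.mul_sum]
      refine Finset.sum_congr rfl fun s _ => ?_
      rw [smul_mul_assoc, mul_smul_comm, h.mul_eq_polarization_smul t s, t.2 s, one_smul]
  change Module.finrank ℝ (Subalgebra.toSubmodule (Subalgebra.center ℝ D)) = _
  have fr := finrank_span_eq_card (b.linearIndependent.comp _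
    (Subtype.val_injective (p := (· ∈ radical μ))))
  rw [key, Nat.card_eq_fintype_card]
  exact fr

open scoped TensorProduct

/-! ### Isomorphisms of matrix algebras -/

/-- Matrices over a product are pairs of matrices. -/
def matrixProdAlgEquiv (n A B : Type*) [Fintype n] [DecidableEq n] [Ring A] [Ring B]
    [Algebra ℝ A] [Algebra ℝ B] :
    Matrix n n (A × B) ≃ₐ[ℝ] Matrix n n A × Matrix n n B :=
  AlgEquiv.ofAlgHom
    ((AlgHom.fst ℝ A B).mapMatrix.prod (AlgHom.snd ℝ A B).mapMatrix)
    { toFun := fun M => Matrix.of fun i j => (M.1 i j, M.2 i j)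
      map_one' := by
        ext i j <;> by_cases hij : i = j <;> simp [Matrix.one_apply, hij]
      map_mul' := fun M N => by
        ext i j <;> simp [Matrix.mul_apply, Prod.fst_sum, Prod.snd_sum]
      map_zero' := rfl
      map_add' := fun _ _ => rfl
      commutes' := fun r => by
        ext i j <;> by_cases hij : i = j <;> simp [Matrix.algebraMap_matrix_apply, hij] }
    (by ext <;> rfl)
    (by ext <;> rfl)

/-- `2 × 2` matrices over `2 ^ m × 2 ^ m` matrices are `2 ^ (m + 1) × 2 ^ (m + 1)` matrices. -/
def matrixTwoPowAlgEquiv (A : Type*) [Ring A] [Algebra ℝ A] (m : ℕ) :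
    Matrix (Fin 2) (Fin 2) (Matrix (Fin (2 ^ m)) (Fin (2 ^ m)) A) ≃ₐ[ℝ]
      Matrix (Fin (2 ^ (m + 1))) (Fin (2 ^ (m + 1))) A :=
  (Matrix.compAlgEquiv (Fin 2) (Fin (2 ^ m)) A ℝ).trans
    (Matrix.reindexAlgEquiv ℝ A (finProdFinEquiv.trans (finCongr (by ring))))

/-- `1 × 1` matrices are scalars. -/
def matrixTwoPowZeroAlgEquiv (A : Type*) [Ring A] [Algebra ℝ A] :
    A ≃ₐ[ℝ] Matrix (Fin (2 ^ 0)) (Fin (2 ^ 0)) A :=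
  letI : DecidableEq Unit := fun a b => decidableEq_of_subsingleton a b
  (Matrix.uniqueAlgEquiv (m := Unit) (R := ℝ)).symm.trans
    (Matrix.reindexAlgEquiv ℝ A (finOneEquiv.symm.trans (finCongr (pow_zero 2).symm)))

/-- The split quaternion algebra is the algebra of `2 × 2` matrices. -/
theorem nonempty_splitQuaternion_algEquiv :
    Nonempty (QuaternionAlgebra ℝ 1 0 1 ≃ₐ[ℝ] Matrix (Fin 2) (Fin 2) ℝ) := by
  let q : QuaternionAlgebra.Basis (Matrix (Fin 2) (Fin 2) ℝ) (1 : ℝ) 0 1 :=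
    { i := !![1, 0; 0, -1]
      j := !![0, 1; 1, 0]
      k := !![0, 1; -1, 0]
      i_mul_i := by ext i j; fin_cases i <;> fin_cases j <;> simp
      j_mul_j := by ext i j; fin_cases i <;> fin_cases j <;> simp
      i_mul_j := by ext i j; fin_cases i <;> fin_cases j <;> simp
      j_mul_i := by ext i j; fin_cases i <;> fin_cases j <;> simp }
  refine ⟨AlgEquiv.ofBijective (QuaternionAlgebra.lift q) ?_⟩
  have inj : Function.Injective (QuaternionAlgebra.lift q).toLinearMap := by
    rw [← LinearMap.ker_eq_bot, LinearMap.ker_eq_bot']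
    intro x hx
    have hx : q.lift x = 0 := hx
    simp only [QuaternionAlgebra.Basis.lift, q] at hx
    have h00 := congrFun (congrFun hx 0) 0
    have h01 := congrFun (congrFun hx 0) 1
    have h10 := congrFun (congrFun hx 1) 0
    have h11 := congrFun (congrFun hx 1) 1
    simp [Matrix.algebraMap_matrix_apply] at h00 h01 h10 h11
    ext <;> simp <;> linarith
  refine ⟨inj, (LinearMap.injective_iff_surjective_of_finrank_eq_finrank ?_).mp inj⟩
  rw [QuaternionAlgebra.finrank_eq_four, Module.finrank_matrix]
  simp

/-- An algebra split off by a split quaternion algebra is an algebra of `2 × 2` matrices. -/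
theorem nonempty_tensor_splitQuaternion_algEquiv (C : Type*) [Ring C] [Algebra ℝ C] :
    Nonempty (C ⊗[ℝ] QuaternionAlgebra ℝ 1 0 1 ≃ₐ[ℝ] Matrix (Fin 2) (Fin 2) C) := by
  obtain ⟨e⟩ := nonempty_splitQuaternion_algEquiv
  exact ⟨(Algebra.TensorProduct.congr AlgEquiv.refl e).trans (matrixEquivTensor (Fin 2) ℝ C).symm⟩

theorem nonempty_real_tensor_algEquiv {C : Type*} (B : Type*) [Ring C] [Algebra ℝ C] [Ring B]
    [Algebra ℝ B] (h : Nonempty (C ≃ₐ[ℝ] ℝ)) : Nonempty (C ⊗[ℝ] B ≃ₐ[ℝ] B) := by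
  obtain ⟨e⟩ := h
  exact ⟨(Algebra.TensorProduct.congr e AlgEquiv.refl).trans (Algebra.TensorProduct.lid ℝ B)⟩

theorem nonempty_real_prod_tensor_algEquiv {C : Type*} (B : Type*) [Ring C] [Algebra ℝ C]
    [Ring B] [Algebra ℝ B] (h : Nonempty (C ≃ₐ[ℝ] ℝ × ℝ)) :
    Nonempty (C ⊗[ℝ] B ≃ₐ[ℝ] B × B) := by
  obtain ⟨e⟩ := h
  exact ⟨(Algebra.TensorProduct.comm ℝ C B).trans <|
    (Algebra.TensorProduct.congr AlgEquiv.refl e).trans <|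
    (Algebra.TensorProduct.prodRight ℝ ℝ B ℝ ℝ).trans <|
    AlgEquiv.prodCongr (Algebra.TensorProduct.rid ℝ ℝ B) (Algebra.TensorProduct.rid ℝ ℝ B)⟩

/-! ### Quadratic forms and orthogonal complements -/

namespace DivGrad

theorem IsAlternatingBicharacter.zero_right {T A : Type*} [AddGroup T] [CommGroup A]
    {β : T → T → A} (hβ : IsAlternatingBicharacter β) (u : T) : β u 0 = 1 := by
  have := hβ.add_right u 0 0
  rw [add_zero] at this
  exact left_eq_mul.mp this

/-- The orthogonal complement of the pair `u`, `v` for the polarization of `μ`. -/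
def orthogonal {T : Type*} [AddCommGroup T] {μ : T → ℤˣ} (hμ : IsQuadraticForm μ) (u v : T) :
    AddSubgroup T where
  carrier := {t | polarization μ u t = 1 ∧ polarization μ v t = 1}
  zero_mem' := ⟨IsAlternatingBicharacter.zero_right hμ u,
    IsAlternatingBicharacter.zero_right hμ v⟩
  add_mem' := by
    rintro s t ⟨h1, h2⟩ ⟨h3, h4⟩
    exact ⟨by rw [IsAlternatingBicharacter.add_right hμ, h1, h3, one_mul],
      by rw [IsAlternatingBicharacter.add_right hμ, h2, h4, one_mul]⟩
  neg_mem' := by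
    rintro t ⟨h1, h2⟩
    have key : ∀ w, polarization μ w t = 1 → polarization μ w (-t) = 1 := fun w hw => by
      have := IsAlternatingBicharacter.add_right hμ w t (-t)
      rwa [add_neg_cancel, IsAlternatingBicharacter.zero_right hμ, hw, one_mul, eq_comm] at this
    exact ⟨key u h1, key v h2⟩

/-- The element `a u + c v`, with the coefficients in `𝔽₂` encoded as Booleans. -/
def planePoint {T : Type*} [AddCommGroup T] (u v : T) (p : Bool × Bool) : T :=
  (if p.1 then u else 0) + (if p.2 then v else 0)

section

variable {T : Type*} [AddCommGroup T] {μ : T → ℤˣ} (hμ : IsQuadraticForm μ) {u v : T}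

include hμ

theorem polarization_left_planePoint (huv : polarization μ u v = -1) (p : Bool × Bool) :
    polarization μ u (planePoint u v p) = if p.2 then -1 else 1 := by
  have h0 := IsAlternatingBicharacter.zero_right hμ u
  have h1 := IsAlternatingBicharacter.self hμ u
  rw [planePoint, IsAlternatingBicharacter.add_right hμ]
  split_ifs <;> simp [h0, h1, huv]

theorem polarization_right_planePoint (huv : polarization μ u v = -1) (p : Bool × Bool) :
    polarization μ v (planePoint u v p) = if p.1 then -1 else 1 := by
  have h0 := IsAlternatingBicharacter.zero_right hμ v
  have h1 := IsAlternatingBicharacter.self hμ v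
  rw [polarization_comm] at huv
  rw [planePoint, IsAlternatingBicharacter.add_right hμ]
  split_ifs <;> simp [h0, h1, huv]

theorem polarization_planePoint {t : T} (ht : t ∈ orthogonal hμ u v) (p : Bool × Bool) :
    polarization μ t (planePoint u v p) = 1 := by
  have h0 := IsAlternatingBicharacter.zero_right hμ t
  have h1 : polarization μ t u = 1 := by rw [polarization_comm]; exact ht.1
  have h2 : polarization μ t v = 1 := by rw [polarization_comm]; exact ht.2
  rw [planePoint, IsAlternatingBicharacter.add_right hμ]
  split_ifs <;> simp [h0, h1, h2]

/-- The group is the direct sum of the plane spanned by an anticommuting pair and its orthogonal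
complement. -/
theorem decomposition_bijective (hT : ∀ t : T, t + t = 0) (huv : polarization μ u v = -1) :
    Function.Bijective fun x : orthogonal hμ u v × (Bool × Bool) =>
      (x.1 : T) + planePoint u v x.2 := by
  have add_right := IsAlternatingBicharacter.add_right hμ
  constructor
  · rintro ⟨⟨s, hs⟩, a, c⟩ ⟨⟨t, ht⟩, a', c'⟩ hst
    change s + planePoint u v (a, c) = t + planePoint u v (a', c') at hst
    have h1 := congrArg (polarization μ u) hst
    have h2 := congrArg (polarization μ v) hst
    rw [add_right, add_right, hs.1, ht.1, polarization_left_planePoint hμ huv,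
      polarization_left_planePoint hμ huv] at h1
    rw [add_right, add_right, hs.2, ht.2, polarization_right_planePoint hμ huv,
      polarization_right_planePoint hμ huv] at h2
    simp only [one_mul] at h1 h2
    have hc : c = c' := by cases c <;> cases c' <;> first | rfl | simp at h1
    have ha : a = a' := by cases a <;> cases a' <;> first | rfl | simp at h2
    subst hc ha
    have := add_right_cancel hst
    subst this
    rfl
  · intro t
    have cases1 := Int.units_eq_one_or (polarization μ u t)
    have cases2 := Int.units_eq_one_or (polarization μ v t)
    let p : Bool × Bool := (decide (polarization μ v t = -1), decide (polarization μ u t = -1))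
    refine ⟨⟨⟨t + planePoint u v p, ?_, ?_⟩, p⟩, ?_⟩
    · rw [add_right, polarization_left_planePoint hμ huv]
      rcases cases1 with h | h <;> simp [p, h]
    · rw [add_right, polarization_right_planePoint hμ huv]
      rcases cases2 with h | h <;> simp [p, h]
    · change t + planePoint u v p + planePoint u v p = t
      rw [add_assoc, hT, add_zero]

theorem card_eq_four_mul [Finite T] (hT : ∀ t : T, t + t = 0)
    (huv : polarization μ u v = -1) : Nat.card T = 4 * Nat.card (orthogonal hμ u v) := by
  rw [← Nat.card_congr (Equiv.ofBijective _ (decomposition_bijective hμ hT huv)), Nat.card_prod,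
    Nat.card_prod]
  simp; ring

/-- The radical is orthogonal to `u` and `v`, and it is the radical of the restriction of `μ` to
their orthogonal complement since the plane of `u` and `v` is orthogonal to that complement. -/
theorem card_radical_orthogonal (hT : ∀ t : T, t + t = 0) (huv : polarization μ u v = -1) :
    Nat.card (radical fun t : orthogonal hμ u v => μ t) = Nat.card (radical μ) := by
  refine Nat.card_congr (Equiv.ofBijective (fun t => ⟨t.1.1, fun s => ?_⟩) ⟨?_, ?_⟩)
  · obtain ⟨⟨s', p⟩, rfl⟩ := (decomposition_bijective hμ hT huv).2 s
    have h1 : polarization μ t.1 s' = 1 := t.2 s'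
    rw [IsAlternatingBicharacter.add_right hμ, h1, polarization_planePoint hμ t.1.2, one_mul]
  · intro s t hst
    exact Subtype.ext (Subtype.ext (Subtype.mk.inj hst))
  · rintro ⟨t, ht⟩
    have hmem : t ∈ orthogonal hμ u v :=
      ⟨by rw [polarization_comm]; exact ht u, by rw [polarization_comm]; exact ht v⟩
    exact ⟨⟨⟨t, hmem⟩, fun s => ht s⟩, rfl⟩

end

/-- The sum of the values of `μ`; its sign is the Arf invariant. -/
noncomputable def signSum {T : Type*} (μ : T → ℤˣ) : ℤ := ∑ᶠ t, ((μ t : ℤˣ) : ℤ)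

theorem arf_eq_sign_signSum {T : Type*} [Finite T] (μ : T → ℤˣ) :
    arf μ = Int.sign (signSum μ) := by
  classical
  have := Fintype.ofFinite T
  have hval : ∀ t, ((μ t : ℤˣ) : ℤ) = (if μ t = 1 then 1 else 0) - (if μ t = -1 then 1 else 0) := by
    intro t
    rcases Int.units_eq_one_or (μ t) with h | h <;> rw [h] <;> decide
  rw [arf, signSum, finsum_eq_sum_of_fintype, Finset.sum_congr rfl fun t _ => hval t,
    Finset.sum_sub_distrib, Finset.sum_boole, Finset.sum_boole, Nat.card_eq_fintype_card,
    Nat.card_eq_fintype_card, Fintype.card_subtype, Fintype.card_subtype]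

theorem signSum_eq_mul {T : Type*} [AddCommGroup T] [Finite T] {μ : T → ℤˣ}
    (hμ : IsQuadraticForm μ) (h0 : μ 0 = 1) {u v : T} (hT : ∀ t : T, t + t = 0)
    (huv : polarization μ u v = -1) :
    signSum μ = (1 + μ u + μ v - μ u * μ v : ℤ) * signSum fun t : orthogonal hμ u v => μ t := by
  have := Fintype.ofFinite T
  have := Fintype.ofFinite (orthogonal hμ u v)
  rw [signSum, signSum, finsum_eq_sum_of_fintype, finsum_eq_sum_of_fintype,
    ← (Equiv.ofBijective _ (decomposition_bijective hμ hT huv)).sum_comp, Fintype.sum_prod_type,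
    Finset.mul_sum]
  refine Finset.sum_congr rfl fun t _ => ?_
  simp only [Equiv.ofBijective_apply, map_add_eq μ (t : T), polarization_planePoint hμ t.2]
  rw [Fintype.sum_prod_type]
  simp [planePoint, h0, map_add_eq μ u v, huv]
  ring

end DivGrad

/-! ### Splitting off a quaternion algebra -/

namespace IsSignedBasis

open DivGrad

variable {T D : Type*} [AddCommGroup T] [Ring D] [Algebra ℝ D] {b : Module.Basis T ℝ D}
  {μ : T → ℤˣ}

/-- The subalgebra spanned by the members of a signed basis with index in a subgroup. -/
def subgroupAlgebra (h : IsSignedBasis b μ) (S : AddSubgroup T) : Subalgebra ℝ D :=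
  (Submodule.span ℝ (Set.range fun t : S => b t)).toSubalgebra
    (Submodule.subset_span ⟨0, h.zero⟩) (fun x y hx hy => by
      induction hx, hy using Submodule.span_induction₂ with
      | mem_mem x y hx hy =>
        obtain ⟨s, rfl⟩ := hx
        obtain ⟨t, rfl⟩ := hy
        obtain ⟨ε, hε⟩ := h.mul s t
        simp only [hε, units_int_smul_eq_real_smul]
        exact Submodule.smul_mem _ _ (Submodule.subset_span ⟨s + t, rfl⟩)
      | zero_left y hy => simp
      | zero_right x hx => simp
      | add_left x y z _ _ _ hx hy => rw [add_mul]; exact add_mem hx hy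
      | add_right x y z _ _ _ hx hy => rw [mul_add]; exact add_mem hx hy
      | smul_left r x y _ _ hx => rw [smul_mul_assoc]; exact Submodule.smul_mem _ _ hx
      | smul_right r x y _ _ hx => rw [mul_smul_comm]; exact Submodule.smul_mem _ _ hx)

/-- The signed basis of the subalgebra attached to a subgroup. -/
noncomputable def subgroupBasis (h : IsSignedBasis b μ) (S : AddSubgroup T) :
    Module.Basis S ℝ (h.subgroupAlgebra S) :=
  Module.Basis.span (v := fun t : S => b t)
    (b.linearIndependent.comp (fun t : S => (t : T)) Subtype.val_injective)

theorem coe_subgroupBasis (h : IsSignedBasis b μ) (S : AddSubgroup T) (t : S) :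
    (h.subgroupBasis S t : D) = b t :=
  congrArg Subtype.val (Module.Basis.span_apply
    (b.linearIndependent.comp (fun t : S => (t : T)) Subtype.val_injective) t)

theorem subgroupBasis_isSignedBasis (h : IsSignedBasis b μ) (S : AddSubgroup T) :
    IsSignedBasis (h.subgroupBasis S) fun t : S => μ t where
  zero := Subtype.ext (by rw [coe_subgroupBasis]; exact h.zero)
  mul s t := by
    obtain ⟨ε, hε⟩ := h.mul s t
    refine ⟨ε, Subtype.ext ?_⟩
    rw [units_int_smul_eq_real_smul] at hε ⊢
    simp only [Subalgebra.coe_mul, Subalgebra.coe_smul, coe_subgroupBasis, AddSubgroup.coe_add, hε]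
  sq s := by
    refine Subtype.ext ?_
    have := h.sq s
    rw [units_int_smul_eq_real_smul] at this ⊢
    simp only [Subalgebra.coe_mul, Subalgebra.coe_smul, coe_subgroupBasis, this, Subalgebra.coe_one]

theorem commute_subgroupAlgebra (h : IsSignedBasis b μ) {S : AddSubgroup T} {w : T}
    (hw : ∀ t ∈ S, polarization μ t w = 1) {x : D} (hx : x ∈ h.subgroupAlgebra S) :
    Commute x (b w) := by
  replace hx : x ∈ Submodule.span ℝ (Set.range fun t : S => b t) := hx
  induction hx using Submodule.span_induction with
  | mem x hx =>
    obtain ⟨t, rfl⟩ := hx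
    have := h.mul_eq_polarization_smul t w
    rwa [hw t t.2, one_smul] at this
  | zero => exact Commute.zero_left _
  | add x y _ _ hx hy => exact hx.add_left hy
  | smul r x _ hx => exact hx.smul_left r

/-- Two anticommuting members of a signed basis generate a quaternion algebra, and the whole
algebra is the tensor product of this quaternion algebra with the subalgebra attached to the
orthogonal complement of the two indices. -/
theorem nonempty_tensor_quaternion_algEquiv [Finite T] (h : IsSignedBasis b μ) {u v : T}
    (huv : polarization μ u v = -1) {c d : ℝ} (hc : c = (μ u : ℤ)) (hd : d = (μ v : ℤ)) :
    Nonempty (h.subgroupAlgebra (orthogonal h.isQuadraticForm u v) ⊗[ℝ] QuaternionAlgebra ℝ c 0 d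
      ≃ₐ[ℝ] D) := by
  set S := orthogonal h.isQuadraticForm u v with hS
  let q : QuaternionAlgebra.Basis D c 0 d :=
    { i := b u
      j := b v
      k := b u * b v
      i_mul_i := by rw [h.sq, units_int_smul_eq_real_smul, hc, zero_smul, add_zero]
      j_mul_j := by rw [h.sq, units_int_smul_eq_real_smul, hd]
      i_mul_j := rfl
      j_mul_i := by
        rw [h.mul_eq_polarization_smul v u, polarization_comm, huv, zero_smul, zero_sub,
          Units.neg_smul, one_smul] }
  have comm : ∀ (x : h.subgroupAlgebra S) (y : QuaternionAlgebra ℝ c 0 d),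
      Commute ((h.subgroupAlgebra S).val x) (QuaternionAlgebra.lift q y) := by
    intro x y
    have hu : Commute (x : D) (b u) := h.commute_subgroupAlgebra
      (fun t ht => by rw [polarization_comm]; exact ht.1) x.2
    have hv : Commute (x : D) (b v) := h.commute_subgroupAlgebra
      (fun t ht => by rw [polarization_comm]; exact ht.2) x.2
    change Commute (x : D) (algebraMap ℝ D y.re + y.imI • b u + y.imJ • b v + y.imK • (b u * b v))
    exact (((Algebra.commute_algebraMap_right _ _).add_right (hu.smul_right _)).add_right
      (hv.smul_right _)).add_right ((hu.mul_right hv).smul_right _)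
  let Φ := Algebra.TensorProduct.lift (h.subgroupAlgebra S).val (QuaternionAlgebra.lift q) comm
  have memS : ∀ t ∈ S, b t ∈ Φ.range := fun t ht =>
    ⟨h.subgroupBasis S ⟨t, ht⟩ ⊗ₜ 1,
      (Algebra.TensorProduct.lift_tmul _ _ comm _ _).trans (by
        rw [map_one, mul_one]; exact h.coe_subgroupBasis S ⟨t, ht⟩)⟩
  have memu : b u ∈ Φ.range := ⟨1 ⊗ₜ ⟨0, 1, 0, 0⟩, by
    simp [Φ, QuaternionAlgebra.Basis.lift, q]⟩
  have memv : b v ∈ Φ.range := ⟨1 ⊗ₜ ⟨0, 0, 1, 0⟩, by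
    simp [Φ, QuaternionAlgebra.Basis.lift, q]⟩
  have memadd : ∀ s t, b s ∈ Φ.range → b t ∈ Φ.range → b (s + t) ∈ Φ.range := by
    intro s t hs ht
    obtain ⟨ε, hε⟩ := h.mul s t
    have : b (s + t) = ε • (b s * b t) := by
      rw [hε, smul_smul, Int.units_mul_self, one_smul]
    rw [this, units_int_smul_eq_real_smul]
    exact Φ.range.smul_mem (mul_mem hs ht) _
  have surj : Function.Surjective Φ.toLinearMap := by
    rw [← LinearMap.range_eq_top, eq_top_iff, ← b.span_eq, Submodule.span_le]
    rintro _ ⟨t, rfl⟩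
    obtain ⟨⟨s, p⟩, rfl⟩ := (decomposition_bijective h.isQuadraticForm h.add_self huv).2 t
    have mem0 : b 0 ∈ Φ.range := by rw [h.zero]; exact one_mem _
    refine memadd _ _ (memS s s.2) (memadd _ _ ?_ ?_)
    · split_ifs <;> assumption
    · split_ifs <;> assumption
  have := Module.Finite.of_basis b
  have := Module.Finite.of_basis (h.subgroupBasis S)
  have hdim : Module.finrank ℝ (h.subgroupAlgebra S ⊗[ℝ] QuaternionAlgebra ℝ c 0 d) =
      Module.finrank ℝ D := by
    rw [Module.finrank_tensorProduct, QuaternionAlgebra.finrank_eq_four,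
      Module.finrank_eq_nat_card_basis b, Module.finrank_eq_nat_card_basis (h.subgroupBasis S),
      card_eq_four_mul h.isQuadraticForm h.add_self huv, mul_comm]
  exact ⟨AlgEquiv.ofBijective Φ
    ⟨(LinearMap.injective_iff_surjective_of_finrank_eq_finrank hdim).mpr surj, surj⟩⟩

/-! ### Algebras of dimension one and two -/

theorem nonempty_algEquiv_real (h : IsSignedBasis b μ) (hT : Nat.card T = 1) :
    Nonempty (D ≃ₐ[ℝ] ℝ) := by
  have := h.nontrivial
  have : Finite T := Nat.finite_of_card_ne_zero (by omega)
  have := Module.Finite.of_basis b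
  have inj : Function.Injective (Algebra.ofId ℝ D).toLinearMap := (algebraMap ℝ D).injective
  exact ⟨(AlgEquiv.ofBijective (Algebra.ofId ℝ D) ⟨inj,
    (LinearMap.injective_iff_surjective_of_finrank_eq_finrank
      (by rw [Module.finrank_self, Module.finrank_eq_nat_card_basis b, hT])).mp inj⟩).symm⟩

theorem nonempty_algEquiv_real_prod (h : IsSignedBasis b μ) (hT : Nat.card T = 2) {z : T}
    (hz : z ≠ 0) (hμ : μ z = 1) : Nonempty (D ≃ₐ[ℝ] ℝ × ℝ) := by
  have : Finite T := Nat.finite_of_card_ne_zero (by omega)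
  have := Module.Finite.of_basis b
  have hsq : b z * b z = 1 := by rw [h.sq, hμ, one_smul]
  -- the two factors are cut out by the idempotents `(1 ± b z) / 2`
  let φ : ℝ × ℝ →ₐ[ℝ] D := AlgHom.ofLinearMap
    { toFun := fun x => ((x.1 + x.2) / 2) • (1 : D) + ((x.1 - x.2) / 2) • b z
      map_add' := fun x y => by simp only [Prod.fst_add, Prod.snd_add]; module
      map_smul' := fun r x => by
        simp only [Prod.smul_fst, Prod.smul_snd, smul_eq_mul, RingHom.id_apply]; module }
    (by simp)
    (fun x y => by
      simp only [LinearMap.coe_mk, AddHom.coe_mk, add_mul, mul_add, smul_mul_assoc,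
        mul_smul_comm, one_mul, mul_one, hsq, Prod.fst_mul, Prod.snd_mul]
      module)
  have inj : Function.Injective φ.toLinearMap := by
    rw [← LinearMap.ker_eq_bot, LinearMap.ker_eq_bot']
    intro x hx
    have hx : ((x.1 + x.2) / 2) • (1 : D) + ((x.1 - x.2) / 2) • b z = 0 := hx
    rw [← h.zero] at hx
    have h0 := congrArg (fun y => b.repr y 0) hx
    have h1 := congrArg (fun y => b.repr y z) hx
    simp [hz, hz.symm] at h0 h1
    ext <;> simp <;> linarith
  exact ⟨(AlgEquiv.ofBijective φ ⟨inj,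
    (LinearMap.injective_iff_surjective_of_finrank_eq_finrank
      (by rw [Module.finrank_prod, Module.finrank_self, Module.finrank_eq_nat_card_basis b,
        hT])).mp inj⟩).symm⟩

theorem nonempty_algEquiv_complex (h : IsSignedBasis b μ) (hT : Nat.card T = 2) {z : T}
    (hμ : μ z = -1) : Nonempty (D ≃ₐ[ℝ] ℂ) := by
  have := h.nontrivial
  have : Finite T := Nat.finite_of_card_ne_zero (by omega)
  have := Module.Finite.of_basis b
  let φ : ℂ →ₐ[ℝ] D :=
    Complex.lift ⟨b z, by rw [h.sq, hμ, Units.neg_smul, one_smul]⟩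
  have inj : Function.Injective φ.toLinearMap := φ.toRingHom.injective
  exact ⟨(AlgEquiv.ofBijective φ ⟨inj,
    (LinearMap.injective_iff_surjective_of_finrank_eq_finrank
      (by rw [Complex.finrank_real_complex, Module.finrank_eq_nat_card_basis b, hT])).mp inj⟩).symm⟩

end IsSignedBasis

/-! ### Classification of algebras with a signed basis -/

/-- `HasMatrixForm D r N s` says that the real algebra `D` is the matrix algebra attached to a
quadratic form on `𝔽₂ ^ N` with Arf invariant `s` whose polarization has a radical of order `r`,
for `r = 1` and `r = 2`. -/
inductive HasMatrixForm (D : Type*) [Ring D] [Algebra ℝ D] : ℕ → ℕ → ℤ → Prop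
  | real (m : ℕ) (e : Nonempty (D ≃ₐ[ℝ] Matrix (Fin (2 ^ m)) (Fin (2 ^ m)) ℝ)) :
      HasMatrixForm D 1 (2 * m) 1
  | quaternion (m : ℕ)
      (e : Nonempty (D ≃ₐ[ℝ] Matrix (Fin (2 ^ m)) (Fin (2 ^ m)) (Quaternion ℝ))) :
      HasMatrixForm D 1 (2 * (m + 1)) (-1)
  | realProd (m : ℕ) (e : Nonempty (D ≃ₐ[ℝ]
      Matrix (Fin (2 ^ m)) (Fin (2 ^ m)) ℝ × Matrix (Fin (2 ^ m)) (Fin (2 ^ m)) ℝ)) :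
      HasMatrixForm D 2 (2 * m + 1) 1
  | complex (m : ℕ) (e : Nonempty (D ≃ₐ[ℝ] Matrix (Fin (2 ^ m)) (Fin (2 ^ m)) ℂ)) :
      HasMatrixForm D 2 (2 * m + 1) 0
  | quaternionProd (m : ℕ) (e : Nonempty (D ≃ₐ[ℝ]
      Matrix (Fin (2 ^ m)) (Fin (2 ^ m)) (Quaternion ℝ) ×
        Matrix (Fin (2 ^ m)) (Fin (2 ^ m)) (Quaternion ℝ))) :
      HasMatrixForm D 2 (2 * (m + 1) + 1) (-1)

theorem nonempty_matrix_succ {C D A : Type*} [Ring C] [Algebra ℝ C] [Ring D] [Algebra ℝ D]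
    [Ring A] [Algebra ℝ A] {m : ℕ} (eD : D ≃ₐ[ℝ] Matrix (Fin 2) (Fin 2) C)
    (eC : Nonempty (C ≃ₐ[ℝ] Matrix (Fin (2 ^ m)) (Fin (2 ^ m)) A)) :
    Nonempty (D ≃ₐ[ℝ] Matrix (Fin (2 ^ (m + 1))) (Fin (2 ^ (m + 1))) A) := by
  obtain ⟨e⟩ := eC
  exact ⟨(eD.trans e.mapMatrix).trans (matrixTwoPowAlgEquiv A m)⟩

theorem nonempty_matrix_prod_succ {C D A : Type*} [Ring C] [Algebra ℝ C] [Ring D] [Algebra ℝ D]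
    [Ring A] [Algebra ℝ A] {m : ℕ} (eD : D ≃ₐ[ℝ] Matrix (Fin 2) (Fin 2) C)
    (eC : Nonempty (C ≃ₐ[ℝ]
      Matrix (Fin (2 ^ m)) (Fin (2 ^ m)) A × Matrix (Fin (2 ^ m)) (Fin (2 ^ m)) A)) :
    Nonempty (D ≃ₐ[ℝ] Matrix (Fin (2 ^ (m + 1))) (Fin (2 ^ (m + 1))) A ×
      Matrix (Fin (2 ^ (m + 1))) (Fin (2 ^ (m + 1))) A) := by
  obtain ⟨e⟩ := eC
  exact ⟨(eD.trans e.mapMatrix).trans <| (matrixProdAlgEquiv (Fin 2) _ _).trans <|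
    AlgEquiv.prodCongr (matrixTwoPowAlgEquiv A m) (matrixTwoPowAlgEquiv A m)⟩

/-- Passing to `2 × 2` matrices raises the rank by two and keeps the Arf invariant. -/
theorem HasMatrixForm.matrix_two {C D : Type*} [Ring C] [Algebra ℝ C] [Ring D] [Algebra ℝ D]
    {r N : ℕ} {s : ℤ} (eD : D ≃ₐ[ℝ] Matrix (Fin 2) (Fin 2) C) (hC : HasMatrixForm C r N s) :
    HasMatrixForm D r (N + 2) s := by
  cases hC with
  | real m e => exact .real (m + 1) (nonempty_matrix_succ eD e)
  | quaternion m e => exact .quaternion (m + 1) (nonempty_matrix_succ eD e)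
  | realProd m e => exact .realProd (m + 1) (nonempty_matrix_prod_succ eD e)
  | complex m e => exact .complex (m + 1) (nonempty_matrix_succ eD e)
  | quaternionProd m e => exact .quaternionProd (m + 1) (nonempty_matrix_prod_succ eD e)

theorem HasMatrixForm.parity {D : Type*} [Ring D] [Algebra ℝ D] {r N : ℕ} {s : ℤ}
    (h : HasMatrixForm D r N s) :
    (r = 1 ∧ ∃ m, N = 2 * m) ∨ (r = 2 ∧ ∃ m, N = 2 * m + 1) := by
  cases h with
  | real m | quaternion m => exact Or.inl ⟨rfl, _, rfl⟩
  | realProd m | complex m | quaternionProd m => exact Or.inr ⟨rfl, _, rfl⟩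

theorem HasMatrixForm.of_even {D : Type*} [Ring D] [Algebra ℝ D] {r m : ℕ} {s : ℤ}
    (h : HasMatrixForm D r (2 * m) s) :
    (s = 1 ∨ s = -1) ∧
      (s = 1 → Nonempty (D ≃ₐ[ℝ] Matrix (Fin (2 ^ m)) (Fin (2 ^ m)) ℝ)) ∧
      (s = -1 → 1 ≤ m ∧ Nonempty (D ≃ₐ[ℝ]
        Matrix (Fin (2 ^ (m - 1))) (Fin (2 ^ (m - 1))) (Quaternion ℝ))) := by
  generalize hN : 2 * m = N at h
  cases h with
  | real k e =>
    obtain rfl : m = k := by omega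
    exact ⟨by decide, fun _ => e, fun h => absurd h (by decide)⟩
  | quaternion k e =>
    obtain rfl : m = k + 1 := by omega
    exact ⟨by decide, fun h => absurd h (by decide), fun _ => ⟨by omega, e⟩⟩
  | realProd k e => omega
  | complex k e => omega
  | quaternionProd k e => omega

theorem HasMatrixForm.of_odd {D : Type*} [Ring D] [Algebra ℝ D] {r m : ℕ} {s : ℤ}
    (h : HasMatrixForm D r (2 * m + 1) s) :
    (s = 1 ∨ s = 0 ∨ s = -1) ∧
      (s = 1 → Nonempty (D ≃ₐ[ℝ]
        (Matrix (Fin (2 ^ m)) (Fin (2 ^ m)) ℝ × Matrix (Fin (2 ^ m)) (Fin (2 ^ m)) ℝ))) ∧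
      (s = 0 → Nonempty (D ≃ₐ[ℝ] Matrix (Fin (2 ^ m)) (Fin (2 ^ m)) ℂ)) ∧
      (s = -1 → 1 ≤ m ∧ Nonempty (D ≃ₐ[ℝ]
        (Matrix (Fin (2 ^ (m - 1))) (Fin (2 ^ (m - 1))) (Quaternion ℝ) ×
          Matrix (Fin (2 ^ (m - 1))) (Fin (2 ^ (m - 1))) (Quaternion ℝ)))) := by
  generalize hN : 2 * m + 1 = N at h
  cases h with
  | real k e => omega
  | quaternion k e => omega
  | realProd k e =>
    obtain rfl : m = k := by omega
    exact ⟨by decide, fun _ => e, fun h => absurd h (by decide), fun h => absurd h (by decide)⟩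
  | complex k e =>
    obtain rfl : m = k := by omega
    exact ⟨by decide, fun h => absurd h (by decide), fun _ => e, fun h => absurd h (by decide)⟩
  | quaternionProd k e =>
    obtain rfl : m = k + 1 := by omega
    exact ⟨by decide, fun h => absurd h (by decide), fun h => absurd h (by decide),
      fun _ => ⟨by omega, e⟩⟩

theorem nonempty_matrix_zero {D A : Type*} [Ring D] [Algebra ℝ D] [Ring A] [Algebra ℝ A]
    (e : Nonempty (D ≃ₐ[ℝ] A)) :
    Nonempty (D ≃ₐ[ℝ] Matrix (Fin (2 ^ 0)) (Fin (2 ^ 0)) A) := by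
  obtain ⟨e⟩ := e
  exact ⟨e.trans (matrixTwoPowZeroAlgEquiv A)⟩

theorem nonempty_matrix_prod_zero {D A : Type*} [Ring D] [Algebra ℝ D] [Ring A] [Algebra ℝ A]
    (e : Nonempty (D ≃ₐ[ℝ] A × A)) :
    Nonempty (D ≃ₐ[ℝ]
      Matrix (Fin (2 ^ 0)) (Fin (2 ^ 0)) A × Matrix (Fin (2 ^ 0)) (Fin (2 ^ 0)) A) := by
  obtain ⟨e⟩ := e
  exact ⟨e.trans (AlgEquiv.prodCongr (matrixTwoPowZeroAlgEquiv A) (matrixTwoPowZeroAlgEquiv A))⟩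

namespace DivGrad

theorem arf_eq_one_of_forall {T : Type*} [Finite T] [Nonempty T] {μ : T → ℤˣ}
    (h : ∀ t, μ t = 1) : arf μ = 1 := by
  have := Fintype.ofFinite T
  rw [arf_eq_sign_signSum, signSum, finsum_eq_sum_of_fintype, Int.sign_eq_one_iff_pos]
  simp [h, Fintype.card_pos]

theorem arf_eq_zero_of_card_two {T : Type*} [AddCommGroup T] {μ : T → ℤˣ} (hT : Nat.card T = 2)
    (h0 : μ 0 = 1) {z : T} (hz : μ z = -1) : arf μ = 0 := by
  classical
  have : Finite T := Nat.finite_of_card_ne_zero (by omega)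
  have := Fintype.ofFinite T
  have hz0 : (0 : T) ≠ z := by rintro rfl; rw [h0] at hz; exact absurd hz (by decide)
  have huniv : (Finset.univ : Finset T) = {0, z} := by
    symm
    rw [← Finset.card_eq_iff_eq_univ, Finset.card_pair hz0, ← Nat.card_eq_fintype_card, hT]
  rw [arf_eq_sign_signSum, signSum, finsum_eq_sum_of_fintype, huniv, Finset.sum_pair hz0, h0, hz]
  decide

end DivGrad

namespace IsSignedBasis

open DivGrad

variable {T D : Type*} [AddCommGroup T] [Ring D] [Algebra ℝ D] {b : Module.Basis T ℝ D}
  {μ : T → ℤˣ}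

/-- The case of index groups of order one or two, in which the algebra is `ℝ`, `ℝ × ℝ` or `ℂ`. -/
theorem hasMatrixForm_of_card_eq_one_or_two (h : IsSignedBasis b μ)
    (hr : Nat.card T = 1 ∨ Nat.card T = 2) :
    ∃ N, Nat.card T = 2 ^ N ∧ HasMatrixForm D (Nat.card T) N (arf μ) := by
  have : Finite T := Nat.finite_of_card_ne_zero (by omega)
  rcases hr with hT | hT
  · have hs := (Nat.card_eq_one_iff_unique.mp hT).1
    have hμ : arf μ = 1 := arf_eq_one_of_forall fun t => by
      rw [Subsingleton.elim t 0, h.map_zero]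
    rw [hT, hμ]
    exact ⟨0, rfl, .real 0 (nonempty_matrix_zero (h.nonempty_algEquiv_real hT))⟩
  · obtain ⟨z, hz, huniq⟩ := (Nat.card_eq_two_iff' (0 : T)).mp hT
    rcases Int.units_eq_one_or (μ z) with hμz | hμz
    · have hμ : arf μ = 1 := arf_eq_one_of_forall fun t => by
        by_cases ht : t = 0
        · rw [ht, h.map_zero]
        · rw [huniq t ht, hμz]
      rw [hT, hμ]
      exact ⟨1, rfl, .realProd 0
        (nonempty_matrix_prod_zero (h.nonempty_algEquiv_real_prod hT hz hμz))⟩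
    · have hμ : arf μ = 0 := arf_eq_zero_of_card_two hT h.map_zero hμz
      rw [hT, hμ]
      exact ⟨1, rfl, .complex 0 (nonempty_matrix_zero (h.nonempty_algEquiv_complex hT hμz))⟩

/-- The anisotropic case: any two anticommuting members of the basis have square `-1`. Then `μ`
is trivial on the orthogonal complement of an anticommuting pair, so that this complement is the
radical, and a single factor `ℍ` splits off. -/
theorem hasMatrixForm_of_anisotropic [Finite T] (h : IsSignedBasis b μ)
    (haniso : ∀ u v, polarization μ u v = -1 → μ v = -1) {u v : T}
    (huv : polarization μ u v = -1)
    (hr : Nat.card (radical μ) = 1 ∨ Nat.card (radical μ) = 2) :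
    ∃ N, Nat.card T = 2 ^ N ∧ HasMatrixForm D (Nat.card (radical μ)) N (arf μ) := by
  have hq := h.isQuadraticForm
  have hμv : μ v = -1 := haniso u v huv
  have hμu : μ u = -1 := haniso v u (by rw [polarization_comm, huv])
  have hone : ∀ t : orthogonal hq u v, μ t = 1 := fun t => by
    have h1 : polarization μ u (t + v) = -1 := by
      rw [IsAlternatingBicharacter.add_right hq, t.2.1, huv, one_mul]
    have h2 := haniso u _ h1
    have h3 : polarization μ t v = 1 := by rw [polarization_comm]; exact t.2.2
    rw [map_add_eq μ, h3, mul_one, hμv, mul_neg, mul_one] at h2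
    exact neg_injective h2
  have hrad : Nat.card (orthogonal hq u v) = Nat.card (radical μ) := by
    rw [← card_radical_orthogonal hq h.add_self huv]
    refine (Nat.card_congr (Equiv.subtypeUnivEquiv fun t s => ?_)).symm
    simp only [polarization, hone]
    simp
  have hsum : arf μ = -1 := by
    have h1 : arf (fun t : orthogonal hq u v => μ t) = 1 := arf_eq_one_of_forall hone
    rw [arf_eq_sign_signSum] at h1 ⊢
    rw [signSum_eq_mul hq h.map_zero h.add_self huv, Int.sign_mul, h1, hμu, hμv]
    decide
  have hC := h.subgroupBasis_isSignedBasis (orthogonal hq u v)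
  obtain ⟨e⟩ := h.nonempty_tensor_quaternion_algEquiv huv (c := -1) (d := -1)
    (by rw [hμu]; simp) (by rw [hμv]; simp)
  have hcard := card_eq_four_mul hq h.add_self huv
  rw [hrad] at hcard
  rw [hsum]
  rcases hr with hr | hr
  · rw [hr] at hcard hrad ⊢
    obtain ⟨e'⟩ := nonempty_real_tensor_algEquiv (QuaternionAlgebra ℝ (-1) 0 (-1))
      (hC.nonempty_algEquiv_real hrad)
    exact ⟨2, hcard, .quaternion 0 (nonempty_matrix_zero ⟨e.symm.trans e'⟩)⟩
  · rw [hr] at hcard hrad ⊢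
    obtain ⟨z, hz, -⟩ := (Nat.card_eq_two_iff' (0 : orthogonal hq u v)).mp hrad
    obtain ⟨e'⟩ := nonempty_real_prod_tensor_algEquiv (QuaternionAlgebra ℝ (-1) 0 (-1))
      (hC.nonempty_algEquiv_real_prod hrad hz (hone z))
    exact ⟨3, hcard, .quaternionProd 0 (nonempty_matrix_prod_zero ⟨e.symm.trans e'⟩)⟩

end IsSignedBasis

open DivGrad in
/-- The classification, by induction on the order of the index group: as long as there are two
anticommuting basis members of square `1`, a factor `M₂(ℝ)` splits off. -/
theorem IsSignedBasis.hasMatrixForm (n : ℕ) {T D : Type*} [AddCommGroup T] [Finite T] [Ring D]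
    [Algebra ℝ D] {b : Module.Basis T ℝ D} {μ : T → ℤˣ} (h : IsSignedBasis b μ)
    (hn : Nat.card T = n) (hr : Nat.card (radical μ) = 1 ∨ Nat.card (radical μ) = 2) :
    ∃ N, Nat.card T = 2 ^ N ∧ HasMatrixForm D (Nat.card (radical μ)) N (arf μ) := by
  induction n using Nat.strong_induction_on generalizing T D with
  | _ n ih =>
  have hq := h.isQuadraticForm
  by_cases hhyp : ∃ u v, polarization μ u v = -1 ∧ μ u = 1 ∧ μ v = 1
  · obtain ⟨u, v, huv, hu, hv⟩ := hhyp
    have hcard := card_eq_four_mul hq h.add_self huv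
    have hrad := card_radical_orthogonal hq h.add_self huv
    have hpos : 0 < Nat.card (orthogonal hq u v) := Nat.card_pos
    obtain ⟨N, hN, hC⟩ := ih (Nat.card (orthogonal hq u v)) (by omega)
      (h.subgroupBasis_isSignedBasis (orthogonal hq u v)) rfl (by rwa [hrad])
    obtain ⟨e⟩ := h.nonempty_tensor_quaternion_algEquiv huv (c := 1) (d := 1)
      (by rw [hu]; simp) (by rw [hv]; simp)
    obtain ⟨e'⟩ := nonempty_tensor_splitQuaternion_algEquiv
      (h.subgroupAlgebra (orthogonal hq u v))
    have harf : arf μ = arf fun t : orthogonal hq u v => μ t := by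
      rw [arf_eq_sign_signSum, arf_eq_sign_signSum,
        signSum_eq_mul hq h.map_zero h.add_self huv, Int.sign_mul, hu, hv]
      exact one_mul _
    refine ⟨N + 2, by rw [hcard, hN]; ring, ?_⟩
    rw [harf, ← hrad]
    exact hC.matrix_two (e.symm.trans e')
  · push Not at hhyp
    -- among `u`, `v`, `u + v` with `u`, `v` anticommuting, an odd number has `μ = -1`
    have haniso : ∀ u v, polarization μ u v = -1 → μ v = -1 := by
      intro u v huv
      rcases Int.units_eq_one_or (μ v) with hv | hv
      · exfalso
        rcases Int.units_eq_one_or (μ u) with hu | hu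
        · exact hhyp u v huv hu hv
        · refine hhyp v (u + v) ?_ hv ?_
          · rw [IsAlternatingBicharacter.add_right hq, IsAlternatingBicharacter.self hq,
              polarization_comm, huv, mul_one]
          · rw [map_add_eq μ, hu, hv, huv]; rfl
      · exact hv
    by_cases hβ : ∃ u v, polarization μ u v = -1
    · obtain ⟨u, v, huv⟩ := hβ
      exact h.hasMatrixForm_of_anisotropic haniso huv hr
    · push Not at hβ
      have hβ' : ∀ u v, polarization μ u v = 1 := fun u v =>
        (Int.units_eq_one_or _).resolve_right (hβ u v)
      have hrad : Nat.card (radical μ) = Nat.card T :=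
        Nat.card_congr (Equiv.subtypeUnivEquiv fun t => hβ' t)
      rw [hrad] at hr ⊢
      exact h.hasMatrixForm_of_card_eq_one_or_two hr

/-! ### The signed basis of a division grading -/

namespace DivGrad

/-- A subgroup whose elements commute, as a commutative group extending its group structure. -/
abbrev addCommGroupOfComm {G : Type*} [AddGroup G] (T : AddSubgroup G)
    (hcomm : ∀ s t : T, s + t = t + s) : AddCommGroup T :=
  { (inferInstance : AddGroup T) with add_comm := hcomm }

/-- Let `A * B = c Z` and `B * A = d Z`, where `A`, `B`, `Z` have square `±1`. Evaluating
`A * B * (B * A)` and `A * B * (A * B)` gives `c d = ± 1` and `c ^ 3 = ± d`, whence `c = ± 1`. -/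
theorem sign_of_mul_eq_smul {D : Type*} [Ring D] [Nontrivial D] [Algebra ℝ D] {A B Z : D}
    {c d α β ζ : ℝ} (hα : α ^ 2 = 1) (hβ : β ^ 2 = 1) (hζ : ζ ^ 2 = 1)
    (hA : A * A = α • (1 : D)) (hB : B * B = β • (1 : D)) (hZ : Z * Z = ζ • (1 : D))
    (hAB : A * B = c • Z) (hBA : B * A = d • Z) : c = 1 ∨ c = -1 := by
  have inj : ∀ x y : ℝ, x • (1 : D) = y • (1 : D) → x = y := fun x y hxy =>
    smul_left_injective ℝ one_ne_zero hxy
  have e1 : c * d * ζ = α * β := inj _ _ <| calc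
    (c * d * ζ) • (1 : D) = A * B * (B * A) := by
      rw [hAB, hBA, smul_mul_smul_comm, hZ, smul_smul]
    _ = A * (B * B) * A := by simp only [mul_assoc]
    _ = (α * β) • (1 : D) := by
      rw [hB, mul_smul_comm, mul_one, smul_mul_assoc, hA, smul_smul, mul_comm]
  have e2 : c ^ 3 * ζ = d * (α * β) := inj _ _ <| calc
    (c ^ 3 * ζ) • (1 : D) = c • (A * B * (A * B)) := by
      rw [hAB, smul_mul_smul_comm, hZ, smul_smul, smul_smul]; ring_nf
    _ = c • (A * (B * A) * B) := by simp only [mul_assoc]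
    _ = d • (A * (c • Z) * B) := by
      rw [hBA]; simp only [mul_smul_comm, smul_mul_assoc]; rw [smul_comm]
    _ = d • (A * A * (B * B)) := by rw [← hAB]; simp only [mul_assoc]
    _ = (d * (α * β)) • (1 : D) := by
      rw [hA, hB, smul_mul_smul_comm, mul_one, smul_smul]
  have e3 : c ^ 4 = 1 := by
    calc c ^ 4 = c ^ 4 * ζ ^ 2 := by rw [hζ, mul_one]
      _ = c * (c ^ 3 * ζ) * ζ := by ring
      _ = (c * d * ζ) * (α * β) := by rw [e2]; ring
      _ = α ^ 2 * β ^ 2 := by rw [e1]; ring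
      _ = 1 := by rw [hα, hβ, mul_one]
  have e4 : c ^ 2 = 1 := by nlinarith [sq_nonneg c]
  exact sq_eq_one_iff.mp e4

theorem units_int_cast_sq (ε : ℤˣ) : (((ε : ℤ)) : ℝ) ^ 2 = 1 := by
  rcases Int.units_eq_one_or ε with h | h <;> simp [h]

theorem exists_smul_eq_of_mem {G D : Type*} [Ring D] [Algebra ℝ D]
    {𝒜 : G → Submodule ℝ D} (hdim : ∀ g ∈ support 𝒜, Module.finrank ℝ (𝒜 g) = 1) {g : G}
    {x y : D} (hx : x ∈ 𝒜 g) (hx0 : x ≠ 0) (hy : y ∈ 𝒜 g) : ∃ c : ℝ, y = c • x := by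
  have hg : g ∈ support 𝒜 := fun hbot => hx0 (by rw [hbot] at hx; exact hx)
  obtain ⟨c, hc⟩ := (finrank_eq_one_iff_of_nonzero' (⟨x, hx⟩ : 𝒜 g)
    (fun h0 => hx0 (congrArg Subtype.val h0))).mp (hdim g hg) ⟨y, hy⟩
  exact ⟨c, (congrArg Subtype.val hc).symm⟩

/-- Homogeneous elements of the same degree with squares `±1` have the same square. -/
theorem sign_unique {G D : Type*} [Ring D] [Algebra ℝ D] [Nontrivial D]
    {𝒜 : G → Submodule ℝ D} (hdim : ∀ g ∈ support 𝒜, Module.finrank ℝ (𝒜 g) = 1) {g : G}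
    {x y : D} {ε δ : ℤˣ} (hx : x ∈ 𝒜 g) (hy : y ∈ 𝒜 g)
    (hxε : x ^ 2 = algebraMap ℝ D ((ε : ℤ) : ℝ)) (hyδ : y ^ 2 = algebraMap ℝ D ((δ : ℤ) : ℝ)) :
    ε = δ := by
  have hx0 : x ≠ 0 := by
    rintro rfl
    have : (((ε : ℤ)) : ℝ) = 0 := (algebraMap ℝ D).injective (by rw [← hxε]; simp)
    have h1 := units_int_cast_sq ε
    rw [this] at h1
    norm_num at h1
  obtain ⟨c, rfl⟩ := exists_smul_eq_of_mem hdim hx hx0 hy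
  rw [smul_pow, hxε, Algebra.smul_def, ← map_mul] at hyδ
  have hc := (algebraMap ℝ D).injective hyδ
  rcases Int.units_eq_one_or ε with rfl | rfl <;> rcases Int.units_eq_one_or δ with rfl | rfl
  · rfl
  · simp at hc; nlinarith [sq_nonneg c]
  · simp at hc; nlinarith [sq_nonneg c]
  · rfl

section

variable {G D : Type*} [AddGroup G] [Ring D] [Algebra ℝ D] {𝒜 : G → Submodule ℝ D}
  [DecidableEq G] [GradedAlgebra 𝒜]

/-- A nonzero homogeneous element whose degree has order at most two can be rescaled to have
square `±1`. -/
theorem exists_sign_of_square [Nontrivial D] (hdiv : IsDivisionGrading 𝒜)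
    (hdim : ∀ g ∈ support 𝒜, Module.finrank ℝ (𝒜 g) = 1) {g : G} (hg : g ∈ support 𝒜)
    (hgg : g + g = 0) :
    ∃ ε : ℤˣ, ∃ X ∈ 𝒜 g, X ^ 2 = algebraMap ℝ D ((ε : ℤ) : ℝ) := by
  obtain ⟨x, hx, hx0⟩ := Submodule.exists_mem_ne_zero_of_ne_bot hg
  have hxx : x * x ∈ 𝒜 0 := by
    have := SetLike.mul_mem_graded hx hx
    rwa [hgg] at this
  obtain ⟨r, hr⟩ := exists_smul_eq_of_mem hdim (SetLike.one_mem_graded 𝒜) one_ne_zero hxx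
  have hr0 : r ≠ 0 := by
    rintro rfl
    rw [zero_smul] at hr
    exact ((hdiv g x hx hx0).mul (hdiv g x hx hx0)).ne_zero hr
  have habs : 0 < |r| := abs_pos.mpr hr0
  have hs : ((√|r|)⁻¹) ^ 2 = |r|⁻¹ := by rw [inv_pow, Real.sq_sqrt habs.le]
  have hX : ((√|r|)⁻¹ • x) ^ 2 = algebraMap ℝ D (|r|⁻¹ * r) := by
    rw [smul_pow, hs, pow_two, hr, smul_smul, Algebra.algebraMap_eq_smul_one]
  rcases lt_or_gt_of_ne hr0 with hneg | hpos
  · refine ⟨-1, _, Submodule.smul_mem _ _ hx, hX.trans ?_⟩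
    rw [abs_of_neg hneg, inv_neg, neg_mul, inv_mul_cancel₀ hr0]; simp
  · refine ⟨1, _, Submodule.smul_mem _ _ hx, hX.trans ?_⟩
    rw [abs_of_pos hpos, inv_mul_cancel₀ hr0]; simp

/-- Normalized homogeneous elements form a signed basis. -/
theorem exists_isSignedBasis [Nontrivial D]
    (hdim : ∀ g ∈ support 𝒜, Module.finrank ℝ (𝒜 g) = 1) {T : AddSubgroup G}
    (hT : (T : Set G) = support 𝒜) (hcomm : ∀ s t : T, s + t = t + s)
    {μ : T → ℤˣ} (hμ : IsSignOfSquares 𝒜 T μ) :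
    letI := addCommGroupOfComm T hcomm
    ∃ b : Module.Basis T ℝ D, IsSignedBasis b μ := by
  classical
  let := addCommGroupOfComm T hcomm
  choose X hX hsq using hμ
  have hμ0 : μ 0 = 1 := sign_unique hdim (hX 0) (SetLike.one_mem_graded 𝒜) (hsq 0) (by simp)
  -- the representative of degree `0` is chosen to be the identity
  let Y : T → D := fun t => if t = 0 then 1 else X t
  have hY : ∀ t : T, Y t ∈ 𝒜 t := fun t => by
    by_cases ht : t = 0
    · subst ht; simp only [Y, if_true]; exact SetLike.one_mem_graded 𝒜
    · simp only [Y, ht, if_false]; exact hX t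
  have hYsq : ∀ t : T, Y t * Y t = ((μ t : ℤ) : ℝ) • (1 : D) := fun t => by
    by_cases ht : t = 0
    · subst ht; simp [Y, hμ0]
    · simp only [Y, ht, if_false]; rw [← pow_two, hsq, Algebra.algebraMap_eq_smul_one]
  have hY0 : ∀ t : T, Y t ≠ 0 := fun t h0 => by
    have h1 := hYsq t
    rw [h0, mul_zero, eq_comm, smul_eq_zero_iff_left one_ne_zero] at h1
    have h2 := units_int_cast_sq (μ t)
    rw [h1] at h2
    norm_num at h2
  have hint := DirectSum.Decomposition.isInternal 𝒜
  have hli : LinearIndependent ℝ Y :=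
    (hint.submodule_iSupIndep.comp Subtype.val_injective).linearIndependent
      (fun t : T => 𝒜 t) hY hY0
  have hspan : ⊤ ≤ Submodule.span ℝ (Set.range Y) := by
    rw [← hint.submodule_iSup_eq_top]
    refine iSup_le fun g x hx => ?_
    by_cases hg : g ∈ support 𝒜
    · have hgT : g ∈ T := by rw [← SetLike.mem_coe, hT]; exact hg
      obtain ⟨c, rfl⟩ := exists_smul_eq_of_mem hdim (hY ⟨g, hgT⟩) (hY0 _) hx
      exact Submodule.smul_mem _ _ (Submodule.subset_span ⟨_, rfl⟩)
    · have hbot : 𝒜 g = ⊥ := not_not.mp hg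
      rw [hbot, Submodule.mem_bot] at hx
      rw [hx]; exact Submodule.zero_mem _
  refine ⟨Module.Basis.mk hli hspan, ?_, fun u v => ?_, fun u => ?_⟩
  · rw [Module.Basis.mk_apply]; simp [Y]
  · rw [Module.Basis.mk_apply, Module.Basis.mk_apply, Module.Basis.mk_apply]
    have huv : Y u * Y v ∈ 𝒜 (u + v : T) := SetLike.mul_mem_graded (hY u) (hY v)
    have hvu : Y v * Y u ∈ 𝒜 (u + v : T) := by
      rw [hcomm u v]; exact SetLike.mul_mem_graded (hY v) (hY u)
    obtain ⟨c, hc⟩ := exists_smul_eq_of_mem hdim (hY (u + v)) (hY0 _) huv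
    obtain ⟨d, hd⟩ := exists_smul_eq_of_mem hdim (hY (u + v)) (hY0 _) hvu
    rcases sign_of_mul_eq_smul (units_int_cast_sq _) (units_int_cast_sq _) (units_int_cast_sq _)
      (hYsq u) (hYsq v) (hYsq (u + v)) hc hd with rfl | rfl
    · exact ⟨1, by rw [hc, one_smul, one_smul]⟩
    · exact ⟨-1, by rw [hc, neg_smul, one_smul, Units.neg_smul, one_smul]⟩
  · rw [Module.Basis.mk_apply, hYsq, units_int_smul_eq_real_smul]

end

end DivGrad

/-! ### Division gradings with elementary abelian support -/

theorem mainTheorem9 {G D : Type*} [AddGroup G] [DecidableEq G] [Ring D] [Algebra ℝ D]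
    [FiniteDimensional ℝ D]
    (hcenter : Module.finrank ℝ (Subalgebra.center ℝ D) = 1 ∨
      Module.finrank ℝ (Subalgebra.center ℝ D) = 2)
    (𝒜 : G → Submodule ℝ D) [GradedAlgebra 𝒜]
    (hdiv : DivGrad.IsDivisionGrading 𝒜)
    (T : AddSubgroup G) (hT : (T : Set G) = DivGrad.support 𝒜)
    (hdim : ∀ g ∈ DivGrad.support 𝒜, Module.finrank ℝ (𝒜 g) = 1)
    (N : ℕ) (hN : Nonempty (T ≃+ (Fin N → ZMod 2))) :
    (Module.finrank ℝ (Subalgebra.center ℝ D) = 1 ↔ ∃ m : ℕ, N = 2 * m) ∧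
    (Module.finrank ℝ (Subalgebra.center ℝ D) = 2 ↔ ∃ m : ℕ, N = 2 * m + 1) ∧
    (∃! μ : T → ℤˣ, DivGrad.IsSignOfSquares 𝒜 T μ) ∧
    ∀ μ : T → ℤˣ, DivGrad.IsSignOfSquares 𝒜 T μ →
      DivGrad.IsQuadraticForm μ ∧
      (∀ m : ℕ, N = 2 * m →
        (DivGrad.arf μ = 1 ∨ DivGrad.arf μ = -1) ∧
        (DivGrad.arf μ = 1 →
          Nonempty (D ≃ₐ[ℝ] Matrix (Fin (2 ^ m)) (Fin (2 ^ m)) ℝ)) ∧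
        (DivGrad.arf μ = -1 → 1 ≤ m ∧
          Nonempty (D ≃ₐ[ℝ]
            Matrix (Fin (2 ^ (m - 1))) (Fin (2 ^ (m - 1))) (Quaternion ℝ)))) ∧
      (∀ m : ℕ, N = 2 * m + 1 →
        (DivGrad.arf μ = 1 ∨ DivGrad.arf μ = 0 ∨ DivGrad.arf μ = -1) ∧
        (DivGrad.arf μ = 1 →
          Nonempty (D ≃ₐ[ℝ]
            (Matrix (Fin (2 ^ m)) (Fin (2 ^ m)) ℝ × Matrix (Fin (2 ^ m)) (Fin (2 ^ m)) ℝ))) ∧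
        (DivGrad.arf μ = 0 →
          Nonempty (D ≃ₐ[ℝ] Matrix (Fin (2 ^ m)) (Fin (2 ^ m)) ℂ)) ∧
        (DivGrad.arf μ = -1 → 1 ≤ m ∧
          Nonempty (D ≃ₐ[ℝ]
            (Matrix (Fin (2 ^ (m - 1))) (Fin (2 ^ (m - 1))) (Quaternion ℝ) ×
              Matrix (Fin (2 ^ (m - 1))) (Fin (2 ^ (m - 1))) (Quaternion ℝ))))) := by
  obtain ⟨e⟩ := hN
  have hcomm : ∀ s t : T, s + t = t + s := fun s t =>
    e.injective (by rw [map_add, map_add, add_comm])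
  have hexp : ∀ t : T, t + t = 0 := fun t =>
    e.injective (by rw [map_add, map_zero]; exact funext fun _ => CharTwo.add_self_eq_zero _)
  have hcardT : Nat.card T = 2 ^ N := by
    rw [Nat.card_congr e.toEquiv]; simp
  have hnt : Nontrivial D := by
    have h0 : (0 : G) ∈ DivGrad.support 𝒜 := hT ▸ T.zero_mem
    obtain ⟨x, -, hx⟩ := Submodule.exists_mem_ne_zero_of_ne_bot h0
    exact ⟨x, 0, hx⟩
  have hex : ∀ t : T, ∃ ε : ℤˣ, ∃ X ∈ 𝒜 (t : G), X ^ 2 = algebraMap ℝ D ((ε : ℤ) : ℝ) :=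
    fun t => DivGrad.exists_sign_of_square hdiv hdim (hT ▸ t.2) (congrArg Subtype.val (hexp t))
  choose μ₀ hμ₀ using hex
  have hfin : Finite T := Finite.of_equiv _ e.symm.toEquiv
  let := DivGrad.addCommGroupOfComm T hcomm
  -- the order of the radical is the dimension of the center
  have hform : ∀ μ : T → ℤˣ, DivGrad.IsSignOfSquares 𝒜 T μ → DivGrad.IsQuadraticForm μ ∧
      HasMatrixForm D (Module.finrank ℝ (Subalgebra.center ℝ D)) N (DivGrad.arf μ) := by
    intro μ hμ
    obtain ⟨b, hb⟩ := DivGrad.exists_isSignedBasis hdim hT hcomm hμ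
    refine ⟨hb.isQuadraticForm, ?_⟩
    rw [hb.finrank_center] at hcenter ⊢
    obtain ⟨M, hM, hD⟩ := hb.hasMatrixForm _ rfl hcenter
    rw [hcardT] at hM
    rwa [Nat.pow_right_injective le_rfl hM]
  have hparity := (hform μ₀ hμ₀).2.parity
  refine ⟨⟨fun h1 => ?_, ?_⟩, ⟨fun h2 => ?_, ?_⟩, ⟨μ₀, hμ₀, fun ν hν => ?_⟩, fun μ hμ => ?_⟩
  · exact (hparity.resolve_right (by omega)).2
  · rintro ⟨m, hm⟩
    rcases hparity with ⟨h, -⟩ | ⟨-, k, hk⟩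
    · exact h
    · omega
  · exact (hparity.resolve_left (by omega)).2
  · rintro ⟨m, hm⟩
    rcases hparity with ⟨-, k, hk⟩ | ⟨h, -⟩
    · omega
    · exact h
  · funext t
    obtain ⟨X, hX, hXν⟩ := hν t
    obtain ⟨Y, hY, hYμ⟩ := hμ₀ t
    exact DivGrad.sign_unique hdim hX hY hXν hYμ
  · obtain ⟨hquad, hD⟩ := hform μ hμ
    refine ⟨hquad, fun m hm => ?_, fun m hm => ?_⟩
    · subst hm; exact hD.of_even
    · subst hm; exact hD.of_odd
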